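/- Let $X_1,X_2$ be independent and uniform on $[0,1)$, and let $f(X_1,X_2)=1$ if $X_1\ge X_2$ and $f(X_1,X_2)=0$ otherwise. In an interactive protocol, node 1 observes $X_1$, node 2 observes $X_2$, and possibly a leader observes nothing. They transmit symbols one after another. The sequence of symbols transmitted so far determines whether the protocol ends, and with which announced class in $\{0,1\}$; if it does not end, this sequence determines who transmits next and the number $k\ge 1$ of possible symbols. The symbol sent is a measurable function of the sender's own observation and of the symbols transmitted so far. The number of messages is not bounded. A transmitted symbol out of $k$ costs $\log_2 k$ bits, and the sum rate is the expected total cost. The protocol is zero-error if with probability one it ends and announces $f(X_1,X_2)$. In the bit-exchange protocol, in round $j=1,2,\dots$, nodes 1 and 2 send each other the $j$-th digits $b_1,b_2$ of the binary expansions of $X_1,X_2$ (the digits being $\lfloor 2x\rfloor$, with $x$ then replaced by $2x-\lfloor 2x\rfloor$). If $b_1=b_2$ the next round follows; otherwise the protocol ends and announces $1$ if $b_1>b_2$ and $0$ if $b_1<b_2$. Theorem. 1. Every zero-error interactive protocol has sum rate at least $4$ bits. 2. Let $A_i\times B_i$ ($i=1,2,\dots$, with $A_i,B_i$ measurable) be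 a partition of $[0,1)^2$, up to null sets, into countably many rectangles, each contained up to a null set in $\{x_1\ge x_2\}$ or in $\{x_1<x_2\}$. Then its entropy $\sum_i p_i\log_2(1/p_i)$, where $p_i$ is the area of $(A_i\times B_i)\cap[0,1)^2$, is at least $4$ bits. 3. The bit-exchange protocol is zero-error and its sum rate is exactly $4$ bits. Hence it is optimal. -/

import Mathlib

open MeasureTheory Set
open scoped ENNReal

/-- The participants: the node that observes `X₁`, the node that observes `X₂`, and a leader, who
observes nothing.  A protocol may use the leader or not. -/
inductive Party where
  | node1
  | node2
  | leader

/-- What a party observes when `(X₁, X₂) = x` (the leader: a constant, hence nothing). -/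
def Party.observation : Party → ℝ × ℝ → ℝ
  | .node1, x => x.1
  | .node2, x => x.2
  | .leader, _ => 0

/-- What happens next in an interactive protocol: either the session ends and the class `c` is
announced (`true` is the class `f = 1`), or `sender` transmits one of `k` symbols, chosen as
a (measurable) function of its own observation. -/
inductive Move where
  | halt (c : Bool)
  | send (sender : Party) (k : ℕ) (message : ℝ → Fin k) (meas : Measurable message)

/-- A deterministic interactive protocol, with no bound on the number of messages: what happens
next is a function of the list of all symbols transmitted so far (the most recent one first).
So a message depends only on the observation of its sender and on earlier messages. -/
def Protocol : Type := List ℕ → Move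

/-- The number of bits of one transmission: a symbol out of `k` counts `log₂ k` bits. -/
noncomputable def Move.bits : Move → ℝ≥0∞
  | .halt _ => 0
  | .send _ k _ _ => ENNReal.ofReal (Real.logb 2 k)

/-- The law of `(X₁, X₂)`: independent and uniform on `[0,1)`. -/
noncomputable def uniformLaw : Measure (ℝ × ℝ) :=
  (volume.restrict (Ico (0 : ℝ) 1)).prod (volume.restrict (Ico (0 : ℝ) 1))

namespace Protocol

/-- The symbols transmitted during the first `t` steps on input `x`, the most recent one first. -/
def history (P : Protocol) (x : ℝ × ℝ) : ℕ → List ℕ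
  | 0 => []
  | t + 1 =>
    match P (P.history x t) with
    | .halt _ => P.history x t
    | .send s _ m _ => (m (s.observation x) : ℕ) :: P.history x t

/-- The total number of bits transmitted on input `x`, possibly infinite. -/
noncomputable def totalBits (P : Protocol) (x : ℝ × ℝ) : ℝ≥0∞ :=
  ∑' t : ℕ, (P (P.history x t)).bits

/-- The sum rate: the expected total number of bits transmitted. -/
noncomputable def sumRate (P : Protocol) : ℝ≥0∞ :=
  ∫⁻ x, P.totalBits x ∂uniformLaw

/-- With probability one the protocol halts and announces whether `X₁ ≥ X₂`. -/
def ZeroError (P : Protocol) : Prop :=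
  ∀ᵐ x ∂uniformLaw, ∃ (t : ℕ) (c : Bool),
    P (P.history x t) = Move.halt c ∧ (c = true ↔ x.1 ≥ x.2)

end Protocol

/-- The remainders of the binary expansion: `X(0) = x` and `X(j+1) = 2 X(j) - ⌊2 X(j)⌋`. -/
noncomputable def binaryRemainder (x : ℝ) : ℕ → ℝ
  | 0 => x
  | j + 1 => 2 * binaryRemainder x j - ⌊2 * binaryRemainder x j⌋

/-- The binary digit `⌊2 X(j)⌋` of `x ∈ [0,1)`, with digits numbered from `0`
(the reduction modulo `2` in `Fin.ofNat` only matters for `x ∉ [0,1)`). -/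
noncomputable def binaryDigit (j : ℕ) (x : ℝ) : Fin 2 :=
  Fin.ofNat 2 ⌊2 * binaryRemainder x j⌋₊

theorem measurable_binaryRemainder (j : ℕ) : Measurable fun x => binaryRemainder x j := by
  induction j with
  | zero => exact measurable_id
  | succ j ih =>
    have h2 : Measurable fun x => 2 * binaryRemainder x j := ih.const_mul 2
    have h3 : Measurable fun x => ((⌊2 * binaryRemainder x j⌋ : ℤ) : ℝ) :=
      (measurable_of_countable (fun z : ℤ => (z : ℝ))).comp h2.floor
    exact h2.sub h3

theorem measurable_binaryDigit (j : ℕ) : Measurable (binaryDigit j) :=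
  (measurable_of_countable (fun m : ℕ => Fin.ofNat 2 m)).comp
    (Nat.measurable_floor.comp ((measurable_binaryRemainder j).const_mul 2))

/-- The transmission of the digit number `j` of its observation by a party. -/
noncomputable def sendDigit (s : Party) (j : ℕ) : Move :=
  .send s 2 (binaryDigit j) (measurable_binaryDigit j)

/-- The bit-exchange protocol for two nodes: in each round, node 1 and node 2 send each other
the next digit of their observation; they go on to the next round as long as the two digits `b₁`,
`b₂` of the round agree, and otherwise announce class `1` if `b₁ > b₂` and class `0` if
`b₁ < b₂`. -/
noncomputable def bitExchange : Protocol := fun h =>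
  if h.length % 2 = 1 then sendDigit .node2 (h.length / 2)
  else
    match h with
    | b₂ :: b₁ :: _ =>
      if b₁ = b₂ then sendDigit .node1 (h.length / 2) else .halt (decide (b₁ > b₂))
    | _ => sendDigit .node1 (h.length / 2)

/-- A partition of `[0,1)²`, up to null sets, into countably many (combinatorial) rectangles
`A i ×ˢ B i`, possibly empty, each of which lies, up to a null set, in the region `x₁ ≥ x₂` or in
the region `x₁ < x₂`. -/
structure ZeroErrorPartition where
  A : ℕ → Set ℝ
  B : ℕ → Set ℝ
  measurable_A : ∀ i, MeasurableSet (A i)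
  measurable_B : ∀ i, MeasurableSet (B i)
  disjoint : ∀ i j, i ≠ j → uniformLaw ((A i ×ˢ B i) ∩ (A j ×ˢ B j)) = 0
  cover : ∀ᵐ x ∂uniformLaw, ∃ i, x ∈ A i ×ˢ B i
  zeroError : ∀ i, (∀ᵐ x ∂uniformLaw, x ∈ A i ×ˢ B i → x.1 ≥ x.2) ∨
    (∀ᵐ x ∂uniformLaw, x ∈ A i ×ˢ B i → x.1 < x.2)

/-- The entropy, in bits, of a partition: `∑ pᵢ log₂ (1 / pᵢ)`, possibly infinite. -/
noncomputable def ZeroErrorPartition.entropy (Q : ZeroErrorPartition) : ℝ≥0∞ :=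
  ∑' i : ℕ, ENNReal.ofReal
    (Real.negMulLog (uniformLaw (Q.A i ×ˢ Q.B i)).toReal / Real.log 2)

/-! The density `-2 log |x₁ - x₂|` has integral 3 over the unit square. A rectangle that determines
the order of the coordinates is split by a threshold `c`, one side above it and one below. For side
measures `s`, `t`, its share of the density is largest when both sides are intervals abutting `c`,
and is then `3st + s² log s + t² log t - (s+t)² log (s+t)`. The inequality `h(p) ≥ 4p(1-p) log 2` at
`p = s/(s+t)` bounds this by `-st log (st) + (3 - 4 log 2) st` (`two_mul_box_integral_le`). Summing
over a partition gives `3 ≤ entropy + 3 - 4 log 2` in nats, that is, at least 4 bits.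

The inputs that lead to a given halting history form a rectangle, so a protocol induces such a
partition. Kraft's inequality (`tsum_weight_leaf_le_one`) and Gibbs' inequality (`negMulLog_add_le`)
show that the expected cost is at least its entropy.

Equality holds for squares touching the diagonal at a corner, which are the rectangles of bit
exchange. Its cost is bounded above by a geometric series; the matching lower bound is the general
one. -/

/-! ### The binary entropy inequality. -/

/-- The binary entropy `h(p)` is at least `4 p (1 - p) log 2`, in homogeneous form. -/
theorem four_log_two_mul_le_entropy {a b : ℝ} (ha : 0 < a) (hb : 0 < b) :
    a * (a + b) * Real.log a + b * (a + b) * Real.log b + 4 * Real.log 2 * (a * b)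
      ≤ (a + b) ^ 2 * Real.log (a + b) := by
  set s := a + b with hs
  have hs0 : 0 < s := by positivity
  -- `H 0 = 0`, and `H 1 ≥ 0` is the claim. The parameter makes the derivative rational, with
  -- numerator `a b t² (a - b)²`; equality therefore occurs at `a = b`.
  let H : ℝ → ℝ := fun t => s * a * (Real.log s - Real.log (s - t * b))
    + s * b * (Real.log s - Real.log (s - t * a)) + 4 * (a * b) * Real.log (1 - t / 2)
  have hd : ∀ t ∈ Icc (0 : ℝ) 1, HasDerivAt H
      (s * a * (b / (s - t * b)) + s * b * (a / (s - t * a)) - 4 * (a * b) * (1 / (2 - t))) t := by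
    intro t ht
    have h1 : 0 < s - t * b := by nlinarith [ht.2]
    have h2 : 0 < s - t * a := by nlinarith [ht.2]
    have h3 : 0 < 1 - t / 2 := by linarith [ht.2]
    have h4 : 2 - t ≠ 0 := by linarith [ht.2]
    have d1 : HasDerivAt (fun t => s - t * b) (-(1 * b)) t :=
      ((hasDerivAt_id t).mul_const b).const_sub s
    have d2 : HasDerivAt (fun t => s - t * a) (-(1 * a)) t :=
      ((hasDerivAt_id t).mul_const a).const_sub s
    have d3 : HasDerivAt (fun t : ℝ => 1 - t / 2) (-(1 / 2)) t :=
      ((hasDerivAt_id t).div_const 2).const_sub 1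
    have d := ((((d1.log h1.ne').const_sub (Real.log s)).const_mul (s * a)).add
      (((d2.log h2.ne').const_sub (Real.log s)).const_mul (s * b))).add
      ((d3.log h3.ne').const_mul (4 * (a * b)))
    refine d.congr_deriv ?_
    have h5 : -(1 / 2) / (1 - t / 2) = -(1 / (2 - t)) := by
      rw [show 1 - t / 2 = (2 - t) / 2 by ring]; field_simp
    rw [h5]; ring
  have hmono : MonotoneOn H (Icc 0 1) := by
    refine monotoneOn_of_deriv_nonneg (convex_Icc 0 1)
      (fun t ht => (hd t ht).continuousAt.continuousWithinAt)
      (fun t ht => (hd t (interior_subset ht)).differentiableAt.differentiableWithinAt) ?_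
    intro t ht
    have ht := interior_subset ht
    rw [(hd t ht).deriv]
    have h1 : 0 < s - t * b := by nlinarith [ht.2]
    have h2 : 0 < s - t * a := by nlinarith [ht.2]
    have h4 : 0 < 2 - t := by linarith [ht.2]
    have : s * a * (b / (s - t * b)) + s * b * (a / (s - t * a)) - 4 * (a * b) * (1 / (2 - t))
        = a * b * (t ^ 2 * (a - b) ^ 2) / ((s - t * b) * (s - t * a) * (2 - t)) := by
      have n1 := h1.ne'
      have n2 := h2.ne'
      have n4 := h4.ne'
      rw [eq_div_iff (by positivity)]
      have c1 : b / (s - t * b) * (s - t * b) = b := div_mul_cancel₀ _ n1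
      have c2 : a / (s - t * a) * (s - t * a) = a := div_mul_cancel₀ _ n2
      have c4 : 1 / (2 - t) * (2 - t) = 1 := div_mul_cancel₀ _ n4
      linear_combination s * a * (s - t * a) * (2 - t) * c1 + s * b * (s - t * b) * (2 - t) * c2
        - 4 * (a * b) * (s - t * b) * (s - t * a) * c4
    rw [this]; positivity
  have h01 := hmono (left_mem_Icc.2 zero_le_one) (right_mem_Icc.2 zero_le_one) zero_le_one
  have e1 : s - 1 * b = a := by rw [hs]; ring
  have e2 : s - 1 * a = b := by rw [hs]; ring
  have e3 : Real.log (1 - 1 / 2) = - Real.log 2 := by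
    rw [show (1 : ℝ) - 1 / 2 = 2⁻¹ by norm_num, Real.log_inv]
  simp only [H, e1, e2, e3] at h01
  simp only [zero_mul, sub_zero, sub_self, mul_zero, zero_div, Real.log_one, add_zero] at h01
  have : s ^ 2 * Real.log s = s * a * Real.log s + s * b * Real.log s := by
    rw [hs]; ring
  rw [this]; linarith

/-! ### Rearrangement on the half-line. -/

/-- Among the sets of positive reals of a given measure, an initial interval maximizes the integral
of an antitone function. -/
theorem setLIntegral_le_of_antitoneOn {g : ℝ → ℝ≥0∞} (hg : AntitoneOn g (Ioi 0)) {S : Set ℝ}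
    (hS : MeasurableSet S) (hS0 : S ⊆ Ioi 0) {s : ℝ} (hs : volume S = ENNReal.ofReal s) :
    ∫⁻ x in S, g x ≤ ∫⁻ x in Ioc 0 s, g x := by
  rcases le_or_gt s 0 with h0 | h0
  · rw [setLIntegral_measure_zero _ _ (by rw [hs, ENNReal.ofReal_of_nonpos h0])]
    exact zero_le
  have hI : MeasurableSet (Ioc 0 s) := measurableSet_Ioc
  rw [← lintegral_inter_add_sdiff g S hI, ← lintegral_inter_add_sdiff g (Ioc 0 s) hS,
    inter_comm S]
  have hvol : volume (S \ Ioc 0 s) = volume (Ioc 0 s \ S) := by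
    have h1 := measure_inter_add_sdiff (μ := volume) S hI
    have h2 := measure_inter_add_sdiff (μ := volume) (Ioc 0 s) hS
    rw [Real.volume_Ioc, sub_zero, ← hs, ← h1, inter_comm] at h2
    refine ((ENNReal.add_right_inj ?_).1 h2).symm
    exact ne_top_of_le_ne_top (by rw [hs]; exact ENNReal.ofReal_ne_top)
      (measure_mono inter_subset_left)
  -- The two differences have equal measure, and `g s` bounds `g` from above on the first and from
  -- below on the second.
  refine add_le_add le_rfl ?_
  calc ∫⁻ x in S \ Ioc 0 s, g x ≤ ∫⁻ _ in S \ Ioc 0 s, g s := by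
        refine setLIntegral_mono' (hS.diff hI) fun x hx => ?_
        have hx0 : 0 < x := hS0 hx.1
        have : s < x := by
          by_contra h
          exact hx.2 ⟨hx0, not_lt.1 h⟩
        exact hg h0 hx0 this.le
    _ = ∫⁻ _ in Ioc 0 s \ S, g s := by simp only [setLIntegral_const, hvol]
    _ ≤ ∫⁻ x in Ioc 0 s \ S, g x :=
        setLIntegral_mono' (hI.diff hS) fun x hx => hg hx.1.1 h0 hx.1.2

/-- The one-dimensional rearrangement is used twice: in `v` for each fixed `u`, then in `u`, since
the inner integral over an interval is itself antitone in `u`. -/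
theorem setLIntegral_setLIntegral_le_of_antitoneOn {k : ℝ → ℝ≥0∞} (hk : AntitoneOn k (Ioi 0))
    {S T : Set ℝ} (hS : MeasurableSet S) (hS0 : S ⊆ Ioi 0) (hT : MeasurableSet T)
    (hT0 : T ⊆ Ioi 0) {s t : ℝ} (hs : volume S = ENNReal.ofReal s)
    (ht : volume T = ENNReal.ofReal t) :
    ∫⁻ u in S, ∫⁻ v in T, k (u + v) ≤ ∫⁻ u in Ioc 0 s, ∫⁻ v in Ioc 0 t, k (u + v) := by
  calc ∫⁻ u in S, ∫⁻ v in T, k (u + v) ≤ ∫⁻ u in S, ∫⁻ v in Ioc 0 t, k (u + v) := by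
        refine setLIntegral_mono' hS fun u hu => ?_
        have hu0 : 0 < u := hS0 hu
        refine setLIntegral_le_of_antitoneOn ?_ hT hT0 ht
        intro v hv w hw hvw
        exact hk (add_pos hu0 hv) (add_pos hu0 hw) (by linarith)
    _ ≤ _ := by
        refine setLIntegral_le_of_antitoneOn ?_ hS hS0 hs
        intro u hu w hw huw
        refine setLIntegral_mono' measurableSet_Ioc fun v hv => ?_
        exact hk (add_pos hu hv.1) (add_pos hw hv.1) (by linarith)

/-! ### Logarithmic integrals. -/

theorem setLIntegral_Ioc_ofReal {f : ℝ → ℝ} {a b : ℝ} (hab : a ≤ b)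
    (hf : IntervalIntegrable f volume a b) (h0 : ∀ x ∈ Ioc a b, 0 ≤ f x) :
    ∫⁻ x in Ioc a b, ENNReal.ofReal (f x) = ENNReal.ofReal (∫ x in a..b, f x) := by
  rw [intervalIntegral.integral_of_le hab, ofReal_integral_eq_lintegral_ofReal
    ((intervalIntegrable_iff_integrableOn_Ioc_of_le hab).1 hf)]
  exact (ae_restrict_iff' measurableSet_Ioc).2 (Filter.Eventually.of_forall h0)

theorem integral_id_mul_log {a b : ℝ} (ha : 0 ≤ a) (hab : a ≤ b) :
    ∫ x in a..b, x * Real.log x =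
      (b ^ 2 / 2 * Real.log b - b ^ 2 / 4) - (a ^ 2 / 2 * Real.log a - a ^ 2 / 4) := by
  -- Factoring out `x * log x`, which is continuous at 0, allows the endpoint `a = 0`.
  have hc : Continuous fun x : ℝ => x ^ 2 / 2 * Real.log x - x ^ 2 / 4 := by
    have : (fun x : ℝ => x ^ 2 / 2 * Real.log x - x ^ 2 / 4)
        = fun x => x / 2 * (x * Real.log x) - x ^ 2 / 4 := by ext x; ring
    rw [this]
    exact ((continuous_id.div_const 2).mul Real.continuous_mul_log).sub (by fun_prop)
  refine intervalIntegral.integral_eq_sub_of_hasDerivAt_of_le hab hc.continuousOn ?_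
    (Real.continuous_mul_log.intervalIntegrable _ _)
  intro x hx
  have hx0 : x ≠ 0 := (lt_of_le_of_lt ha hx.1).ne'
  have d := ((((hasDerivAt_pow 2 x).div_const 2).mul (Real.hasDerivAt_log hx0))).sub
    ((hasDerivAt_pow 2 x).div_const 4)
  refine d.congr_deriv ?_
  field_simp
  ring

theorem setLIntegral_neg_log_add {u t : ℝ} (hu : 0 ≤ u) (ht : 0 ≤ t) (hut : u + t ≤ 1) :
    ∫⁻ v in Ioc 0 t, ENNReal.ofReal (-Real.log (u + v)) =
      ENNReal.ofReal (t + u * Real.log u - (u + t) * Real.log (u + t)) := by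
  have hint : IntervalIntegrable (fun v => Real.log (u + v)) volume 0 t := by
    have h : IntervalIntegrable Real.log volume u (u + t) :=
      intervalIntegral.intervalIntegrable_log'
    simpa using h.comp_add_left u
  rw [setLIntegral_Ioc_ofReal (f := fun v => -Real.log (u + v)) ht hint.neg]
  · rw [intervalIntegral.integral_neg, intervalIntegral.integral_comp_add_left Real.log u,
      integral_log]
    congr 1; rw [add_zero]; ring
  · intro v hv
    exact neg_nonneg.2 (Real.log_nonpos (by linarith [hv.1]) (by linarith [hv.2]))

theorem setLIntegral_setLIntegral_neg_log_add {s t : ℝ} (hs : 0 ≤ s) (ht : 0 ≤ t)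
    (hst : s + t ≤ 1) :
    ∫⁻ u in Ioc 0 s, ∫⁻ v in Ioc 0 t, ENNReal.ofReal (-Real.log (u + v)) =
      ENNReal.ofReal (3 / 2 * (s * t) + s ^ 2 / 2 * Real.log s + t ^ 2 / 2 * Real.log t
        - (s + t) ^ 2 / 2 * Real.log (s + t)) := by
  rw [setLIntegral_congr_fun measurableSet_Ioc fun u hu =>
    setLIntegral_neg_log_add hu.1.le ht (by linarith [hu.2])]
  have c1 : Continuous fun u : ℝ => u * Real.log u := Real.continuous_mul_log
  have c2 : Continuous fun u : ℝ => (u + t) * Real.log (u + t) :=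
    Real.continuous_mul_log.comp (continuous_add_const t)
  have c3 : Continuous fun u : ℝ => t + u * Real.log u := continuous_const.add c1
  rw [setLIntegral_Ioc_ofReal
    (f := fun u => t + u * Real.log u - (u + t) * Real.log (u + t)) hs ((c3.sub c2).intervalIntegrable _ _)]
  · congr 1
    rw [intervalIntegral.integral_sub (c3.intervalIntegrable _ _)
      (c2.intervalIntegrable _ _), intervalIntegral.integral_add
      (continuous_const.intervalIntegrable _ _) (c1.intervalIntegrable _ _),
      intervalIntegral.integral_const, integral_id_mul_log le_rfl hs,
      intervalIntegral.integral_comp_add_right (fun x => x * Real.log x) t,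
      integral_id_mul_log (by linarith) (by linarith)]
    simp only [smul_eq_mul, zero_add]
    ring
  -- The integrand must be nonnegative to pass through `ENNReal.ofReal`; this follows from `u (log
  -- (u+t) - log u) ≤ t`.
  · intro u hu
    have h1 : 0 ≤ -Real.log (u + t) :=
      neg_nonneg.2 (Real.log_nonpos (by linarith [hu.1]) (by linarith [hu.2]))
    have h2 : Real.log (u + t) - Real.log u ≤ t / u := by
      rw [← Real.log_div (by linarith [hu.1]) hu.1.ne']
      have := Real.log_le_sub_one_of_pos (x := (u + t) / u)
        (div_pos (by linarith [hu.1]) hu.1)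
      have e : (u + t) / u - 1 = t / u := by have := hu.1.ne'; field_simp; ring
      linarith
    have h3 : u * (Real.log (u + t) - Real.log u) ≤ t := by
      have := mul_le_mul_of_nonneg_left h2 hu.1.le
      rwa [mul_div_cancel₀ _ hu.1.ne'] at this
    nlinarith [mul_nonneg ht h1]

theorem measurable_neg_log_sub :
    Measurable fun x : ℝ × ℝ => ENNReal.ofReal (-Real.log (x.1 - x.2)) :=
  (Real.measurable_log.comp (measurable_fst.sub measurable_snd)).neg.ennreal_ofReal

/-- `Real.log` is the logarithm of the absolute value, so one formula gives the density on both
sides of the diagonal, and `integral_log` applies across the singularity. -/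
theorem lintegral_uniformLaw_neg_log_sub :
    ∫⁻ x, ENNReal.ofReal (-Real.log (x.1 - x.2)) ∂uniformLaw = ENNReal.ofReal (3 / 2) := by
  have hI : volume.restrict (Ico (0 : ℝ) 1) = volume.restrict (Ioc (0 : ℝ) 1) :=
    Measure.restrict_congr_set Ico_ae_eq_Ioc
  rw [uniformLaw, hI, lintegral_prod _ measurable_neg_log_sub.aemeasurable]
  have inner : ∀ x ∈ Ioc (0 : ℝ) 1,
      ∫⁻ y in Ioc (0 : ℝ) 1, ENNReal.ofReal (-Real.log (x - y)) =
        ENNReal.ofReal (1 - x * Real.log x - (1 - x) * Real.log (1 - x)) := by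
    intro x hx
    have hint : IntervalIntegrable (fun y => Real.log (x - y)) volume 0 1 := by
      have h : IntervalIntegrable Real.log volume (x - 0) (x - 1) :=
        intervalIntegral.intervalIntegrable_log'
      simpa using h.comp_sub_left x
    rw [setLIntegral_Ioc_ofReal (f := fun y => -Real.log (x - y)) zero_le_one hint.neg]
    · rw [intervalIntegral.integral_neg, intervalIntegral.integral_comp_sub_left Real.log x,
        integral_log, ← Real.log_neg_eq_log (x - 1)]
      congr 1
      rw [sub_zero, neg_sub]; ring
    · intro y hy
      rw [← Real.log_abs]
      refine neg_nonneg.2 (Real.log_nonpos (abs_nonneg _) (abs_le.2 ⟨?_, ?_⟩))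
      · linarith [hx.1, hy.2]
      · linarith [hx.2, hy.1]
  rw [setLIntegral_congr_fun measurableSet_Ioc inner]
  have c1 : Continuous fun x : ℝ => x * Real.log x := Real.continuous_mul_log
  have c2 : Continuous fun x : ℝ => (1 - x) * Real.log (1 - x) :=
    Real.continuous_mul_log.comp (continuous_const.sub continuous_id)
  have c3 : Continuous fun x : ℝ => 1 - x * Real.log x := continuous_const.sub c1
  rw [setLIntegral_Ioc_ofReal (f := fun x => 1 - x * Real.log x - (1 - x) * Real.log (1 - x))
    zero_le_one ((c3.sub c2).intervalIntegrable _ _)]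
  · congr 1
    rw [intervalIntegral.integral_sub (c3.intervalIntegrable _ _) (c2.intervalIntegrable _ _),
      intervalIntegral.integral_sub (continuous_const.intervalIntegrable _ _)
      (c1.intervalIntegrable _ _), intervalIntegral.integral_const,
      intervalIntegral.integral_comp_sub_left (fun x => x * Real.log x) 1, sub_self, sub_zero,
      integral_id_mul_log le_rfl zero_le_one]
    norm_num
  · intro x hx
    have h1 := mul_nonpos_of_nonneg_of_nonpos hx.1.le (Real.log_nonpos hx.1.le hx.2)
    have h2 := mul_nonpos_of_nonneg_of_nonpos (sub_nonneg.2 hx.2)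
      (Real.log_nonpos (sub_nonneg.2 hx.2) (by linarith [hx.1]))
    linarith

/-! ### The estimate on one rectangle. -/

theorem three_sub_four_log_two_nonneg : 0 ≤ 3 - 4 * Real.log 2 := by
  linarith [Real.log_two_lt_d9]

/-- This is `four_log_two_mul_le_entropy` rearranged. Degenerate sides are treated apart because
that inequality needs positive arguments. -/
theorem two_mul_box_integral_le {s t : ℝ} (hs : 0 ≤ s) (ht : 0 ≤ t) :
    2 * (3 / 2 * (s * t) + s ^ 2 / 2 * Real.log s + t ^ 2 / 2 * Real.log t
        - (s + t) ^ 2 / 2 * Real.log (s + t)) ≤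
      Real.negMulLog (s * t) + (3 - 4 * Real.log 2) * (s * t) := by
  rcases hs.eq_or_lt with rfl | hs
  · simp
  rcases ht.eq_or_lt with rfl | ht
  · simp
  have h := four_log_two_mul_le_entropy hs ht
  rw [Real.negMulLog, Real.log_mul hs.ne' ht.ne']
  linarith

/-- The substitution `x = c + u`, `y = c - v` turns `x - y` into `u + v` with `u, v > 0`, so
rearrangement replaces both sides by intervals starting at 0. -/
theorem two_mul_setLIntegral_neg_log_sub_le_of_subset {c : ℝ} {A B : Set ℝ}
    (hA : MeasurableSet A) (hB : MeasurableSet B) (hAc : A ⊆ Ioc c 1) (hBc : B ⊆ Ico 0 c)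
    (hc0 : 0 ≤ c) (hc1 : c ≤ 1) :
    2 * ∫⁻ x in A, ∫⁻ y in B, ENNReal.ofReal (-Real.log (x - y)) ≤
      ENNReal.ofReal (Real.negMulLog (volume A * volume B).toReal)
        + ENNReal.ofReal (3 - 4 * Real.log 2) * (volume A * volume B) := by
  have hvA : volume A ≤ ENNReal.ofReal (1 - c) := by
    rw [← Real.volume_Ioc]; exact measure_mono hAc
  have hvB : volume B ≤ ENNReal.ofReal c := by
    rw [← sub_zero c, ← Real.volume_Ico]; exact measure_mono hBc
  obtain ⟨s, hs0, hs⟩ : ∃ s : ℝ, 0 ≤ s ∧ volume A = ENNReal.ofReal s :=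
    ⟨_, ENNReal.toReal_nonneg,
      (ENNReal.ofReal_toReal (ne_top_of_le_ne_top ENNReal.ofReal_ne_top hvA)).symm⟩
  obtain ⟨t, ht0, ht⟩ : ∃ t : ℝ, 0 ≤ t ∧ volume B = ENNReal.ofReal t :=
    ⟨_, ENNReal.toReal_nonneg,
      (ENNReal.ofReal_toReal (ne_top_of_le_ne_top ENNReal.ofReal_ne_top hvB)).symm⟩
  have hst : s + t ≤ 1 := by
    rw [hs, ENNReal.ofReal_le_ofReal_iff (by linarith)] at hvA
    rw [ht, ENNReal.ofReal_le_ofReal_iff hc0] at hvB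
    linarith
  have pA := measurePreserving_add_left (volume : Measure ℝ) c
  have pB := Measure.measurePreserving_sub_left (volume : Measure ℝ) c
  have hk : AntitoneOn (fun r : ℝ => ENNReal.ofReal (-Real.log r)) (Ioi 0) := by
    intro x hx y _ hxy
    exact ENNReal.ofReal_le_ofReal (neg_le_neg (Real.log_le_log hx hxy))
  have key := setLIntegral_setLIntegral_le_of_antitoneOn hk (S := (fun u => c + u) ⁻¹' A)
    (T := (fun v => c - v) ⁻¹' B) (pA.measurable hA)
    (fun u hu => by have := (hAc hu).1; simp only [mem_Ioi]; linarith) (pB.measurable hB)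
    (fun v hv => by have := (hBc hv).2; simp only [mem_Ioi]; linarith)
    ((pA.measure_preimage hA.nullMeasurableSet).trans hs)
    ((pB.measure_preimage hB.nullMeasurableSet).trans ht)
  rw [setLIntegral_setLIntegral_neg_log_add hs0 ht0 hst] at key
  have e : ∫⁻ x in A, ∫⁻ y in B, ENNReal.ofReal (-Real.log (x - y)) =
      ∫⁻ u in (fun u => c + u) ⁻¹' A, ∫⁻ v in (fun v => c - v) ⁻¹' B,
        ENNReal.ofReal (-Real.log (u + v)) := by
    rw [← pA.setLIntegral_comp_preimage_emb (MeasurableEquiv.addLeft c).measurableEmbedding]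
    refine lintegral_congr fun u => ?_
    rw [← pB.setLIntegral_comp_preimage_emb (MeasurableEquiv.subLeft c).measurableEmbedding]
    refine lintegral_congr fun v => ?_
    rw [show c + u - (c - v) = u + v by ring]
  have hp : volume A * volume B = ENNReal.ofReal (s * t) := by
    rw [hs, ht, ENNReal.ofReal_mul hs0]
  rw [e, hp, ENNReal.toReal_ofReal (mul_nonneg hs0 ht0),
    ← ENNReal.ofReal_mul three_sub_four_log_two_nonneg]
  calc 2 * _ ≤ 2 * ENNReal.ofReal _ := by gcongr
    _ = ENNReal.ofReal (2 * _) := by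
        rw [ENNReal.ofReal_mul zero_le_two, ENNReal.ofReal_ofNat]
    _ ≤ ENNReal.ofReal _ := ENNReal.ofReal_le_ofReal (two_mul_box_integral_le hs0 ht0)
    _ ≤ _ := ENNReal.ofReal_add_le

/-- The threshold is the essential supremum of `B`: almost every point of `A` is an essential upper
bound of `B`, hence lies above it. The point `c` itself is discarded as a null set, and a null `B`
is treated apart, having no meaningful essential supremum. -/
theorem two_mul_setLIntegral_neg_log_sub_le {A B : Set ℝ}
    (hA : MeasurableSet A) (hB : MeasurableSet B) (hA1 : A ⊆ Ico 0 1) (hB1 : B ⊆ Ico 0 1)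
    (h : ∀ᵐ x ∂volume.restrict A, ∀ᵐ y ∂volume.restrict B, y ≤ x) :
    2 * ∫⁻ x in A, ∫⁻ y in B, ENNReal.ofReal (-Real.log (x - y)) ≤
      ENNReal.ofReal (Real.negMulLog (volume A * volume B).toReal)
        + ENNReal.ofReal (3 - 4 * Real.log 2) * (volume A * volume B) := by
  rcases eq_or_ne (volume B) 0 with hB0 | hB0
  · have : ∀ x : ℝ, ∫⁻ y in B, ENNReal.ofReal (-Real.log (x - y)) = 0 :=
      fun x => setLIntegral_measure_zero _ _ hB0
    simp [this]
  have hne : (ae (volume.restrict B)).NeBot :=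
    ae_neBot.2 (by rwa [Ne, Measure.restrict_eq_zero])
  have hB01 : ∀ᵐ y ∂volume.restrict B, y ∈ Ico (0 : ℝ) 1 := by
    filter_upwards [ae_restrict_mem hB] with y hy using hB1 hy
  have hbdd : Filter.IsBoundedUnder (· ≤ ·) (ae (volume.restrict B)) (fun y : ℝ => y) :=
    ⟨1, Filter.eventually_map.2 (hB01.mono fun y hy => hy.2.le)⟩
  have hcob : Filter.IsCoboundedUnder (· ≤ ·) (ae (volume.restrict B)) (fun y : ℝ => y) :=
    Filter.IsBoundedUnder.isCoboundedUnder_le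
      ⟨0, Filter.eventually_map.2 (hB01.mono fun y hy => hy.1)⟩
  set c : ℝ := essSup (fun y : ℝ => y) (volume.restrict B) with hc
  have hle : ∀ᵐ y ∂volume.restrict B, y ≤ c := ae_le_essSup hbdd
  have hge : ∀ r : ℝ, (∀ᵐ y ∂volume.restrict B, y ≤ r) → c ≤ r :=
    fun r hr => essSup_le_of_ae_le r hr hcob
  have hc0 : 0 ≤ c := by
    obtain ⟨y, hy1, hy2⟩ := (hle.and hB01).exists
    exact hy2.1.trans hy1
  have hc1 : c ≤ 1 := hge 1 (hB01.mono fun y hy => hy.2.le)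
  have eA : A =ᵐ[volume] (A ∩ Ioi c : Set ℝ) := by
    have h1 := (ae_restrict_iff' hA).1 (h.mono fun x hx => hge x hx)
    filter_upwards [h1, Measure.ae_ne volume c] with x hx hxc
    refine propext ⟨fun hxA => ⟨hxA, lt_of_le_of_ne (hx hxA) hxc.symm⟩, fun hx => hx.1⟩
  have eB : B =ᵐ[volume] (B ∩ Iio c : Set ℝ) := by
    filter_upwards [(ae_restrict_iff' hB).1 hle, Measure.ae_ne volume c] with y hy hyc
    refine propext ⟨fun hyB => ⟨hyB, lt_of_le_of_ne (hy hyB) hyc⟩, fun hy => hy.1⟩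
  rw [Measure.restrict_congr_set eA, Measure.restrict_congr_set eB, measure_congr eA,
    measure_congr eB]
  exact two_mul_setLIntegral_neg_log_sub_le_of_subset (hA.inter measurableSet_Ioi)
    (hB.inter measurableSet_Iio) (fun x hx => ⟨hx.2, (hA1 hx.1).2.le⟩)
    (fun y hy => ⟨(hB1 hy.1).1, hy.2⟩) hc0 hc1

/-- A rectangle on which the comparison of the two coordinates is constant carries at most as
much of the density `-2 log |x₁ - x₂|` as its entropy term, up to a multiple of its area. -/
theorem two_mul_setLIntegral_uniformLaw_le {A B : Set ℝ}
    (hA : MeasurableSet A) (hB : MeasurableSet B)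
    (h : (∀ᵐ x ∂uniformLaw, x ∈ A ×ˢ B → x.1 ≥ x.2) ∨
      (∀ᵐ x ∂uniformLaw, x ∈ A ×ˢ B → x.1 < x.2)) :
    2 * ∫⁻ x in A ×ˢ B, ENNReal.ofReal (-Real.log (x.1 - x.2)) ∂uniformLaw ≤
      ENNReal.ofReal (Real.negMulLog (uniformLaw (A ×ˢ B)).toReal)
        + ENNReal.ofReal (3 - 4 * Real.log 2) * uniformLaw (A ×ˢ B) := by
  have hA' := hA.inter (measurableSet_Ico (a := (0 : ℝ)) (b := 1))
  have hB' := hB.inter (measurableSet_Ico (a := (0 : ℝ)) (b := 1))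
  have hr : uniformLaw.restrict (A ×ˢ B) =
      (volume.restrict (A ∩ Ico 0 1)).prod (volume.restrict (B ∩ Ico 0 1)) := by
    rw [uniformLaw, ← Measure.prod_restrict, Measure.restrict_restrict hA,
      Measure.restrict_restrict hB]
  have hv : uniformLaw (A ×ˢ B) = volume (A ∩ Ico 0 1) * volume (B ∩ Ico 0 1) := by
    rw [uniformLaw, Measure.prod_prod, Measure.restrict_apply hA, Measure.restrict_apply hB]
  rw [← ae_restrict_iff' (hA.prod hB), ← ae_restrict_iff' (hA.prod hB), hr] at h
  rw [hr, hv]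
  rcases h with h | h
  · rw [lintegral_prod _ measurable_neg_log_sub.aemeasurable]
    exact two_mul_setLIntegral_neg_log_sub_le hA' hB' inter_subset_right inter_subset_right
      (Measure.ae_ae_of_ae_prod h)
  -- Exchanging the coordinates reduces to the previous case, since the density is symmetric.
  · rw [lintegral_prod_symm _ measurable_neg_log_sub.aemeasurable, mul_comm (volume _)]
    have hs := Measure.measurePreserving_swap.quasiMeasurePreserving.ae h
    refine le_of_eq_of_le ?_ (two_mul_setLIntegral_neg_log_sub_le hB' hA' inter_subset_right
      inter_subset_right ((Measure.ae_ae_of_ae_prod hs).mono fun x hx => hx.mono fun y hy => hy.le))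
    congr 1
    refine lintegral_congr fun y => lintegral_congr fun x => ?_
    rw [← Real.log_neg_eq_log, neg_sub]

/-! ### Summation over a partition. -/

/-- The entropy of a countable family of disjoint rectangles that determine the order of the
coordinates almost surely, in natural units, is at least `4 log 2`. -/
theorem four_log_two_le_tsum_negMulLog {ι : Type*} [Countable ι] (A B : ι → Set ℝ)
    (hA : ∀ i, MeasurableSet (A i)) (hB : ∀ i, MeasurableSet (B i))
    (hsum : ∑' i, uniformLaw (A i ×ˢ B i) ≤ 1)
    (hcover : ∀ᵐ x ∂uniformLaw, ∃ i, x ∈ A i ×ˢ B i)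
    (h : ∀ i, (∀ᵐ x ∂uniformLaw, x ∈ A i ×ˢ B i → x.1 ≥ x.2) ∨
      (∀ᵐ x ∂uniformLaw, x ∈ A i ×ˢ B i → x.1 < x.2)) :
    ENNReal.ofReal (4 * Real.log 2) ≤
      ∑' i, ENNReal.ofReal (Real.negMulLog (uniformLaw (A i ×ˢ B i)).toReal) := by
  have h3 : ENNReal.ofReal 3 ≤
      (∑' i, ENNReal.ofReal (Real.negMulLog (uniformLaw (A i ×ˢ B i)).toReal))
        + ENNReal.ofReal (3 - 4 * Real.log 2) := by
    calc ENNReal.ofReal 3 = 2 * ENNReal.ofReal (3 / 2) := by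
          rw [← ENNReal.ofReal_ofNat, ← ENNReal.ofReal_mul zero_le_two]; norm_num
      _ = 2 * ∫⁻ x, ENNReal.ofReal (-Real.log (x.1 - x.2)) ∂uniformLaw := by
          rw [lintegral_uniformLaw_neg_log_sub]
      _ = 2 * ∫⁻ x in ⋃ i, A i ×ˢ B i, ENNReal.ofReal (-Real.log (x.1 - x.2)) ∂uniformLaw := by
          rw [Measure.restrict_eq_self_of_ae_mem (hcover.mono fun x hx => mem_iUnion.2 hx)]
      _ ≤ 2 * ∑' i, ∫⁻ x in A i ×ˢ B i, ENNReal.ofReal (-Real.log (x.1 - x.2)) ∂uniformLaw := by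
          gcongr; exact lintegral_iUnion_le _ _
      _ = ∑' i, 2 * ∫⁻ x in A i ×ˢ B i, ENNReal.ofReal (-Real.log (x.1 - x.2)) ∂uniformLaw :=
          ENNReal.tsum_mul_left.symm
      _ ≤ ∑' i, (ENNReal.ofReal (Real.negMulLog (uniformLaw (A i ×ˢ B i)).toReal)
            + ENNReal.ofReal (3 - 4 * Real.log 2) * uniformLaw (A i ×ˢ B i)) :=
          ENNReal.tsum_le_tsum fun i => two_mul_setLIntegral_uniformLaw_le (hA i) (hB i) (h i)
      _ ≤ _ := by
          rw [ENNReal.tsum_add, ENNReal.tsum_mul_left]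
          gcongr
          exact mul_le_of_le_one_right' hsum
  have e : ENNReal.ofReal 3 =
      ENNReal.ofReal (4 * Real.log 2) + ENNReal.ofReal (3 - 4 * Real.log 2) := by
    rw [← ENNReal.ofReal_add (by have := Real.log_nonneg one_le_two; linarith)
      three_sub_four_log_two_nonneg]
    congr 1; ring
  rw [e] at h3
  exact (ENNReal.add_le_add_iff_right ENNReal.ofReal_ne_top).1 h3

instance : IsProbabilityMeasure uniformLaw := by
  have : IsProbabilityMeasure (volume.restrict (Ico (0 : ℝ) 1)) := ⟨by simp⟩
  unfold uniformLaw
  infer_instance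

theorem four_le_of_four_log_two_le {ι : Type*} {f : ι → ℝ}
    (h : ENNReal.ofReal (4 * Real.log 2) ≤ ∑' i, ENNReal.ofReal (f i)) :
    4 ≤ ∑' i, ENNReal.ofReal (f i / Real.log 2) := by
  have hl : 0 < Real.log 2 := Real.log_pos one_lt_two
  simp_rw [div_eq_mul_inv, ENNReal.ofReal_mul' (inv_nonneg.2 hl.le)]
  rw [ENNReal.tsum_mul_right]
  calc (4 : ℝ≥0∞) = ENNReal.ofReal (4 * Real.log 2) * ENNReal.ofReal (Real.log 2)⁻¹ := by
        rw [← ENNReal.ofReal_mul (by positivity), mul_assoc, mul_inv_cancel₀ hl.ne', mul_one,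
          ENNReal.ofReal_ofNat]
    _ ≤ _ := by gcongr

theorem ZeroErrorPartition.four_le_entropy (Q : ZeroErrorPartition) : 4 ≤ Q.entropy := by
  refine four_le_of_four_log_two_le (four_log_two_le_tsum_negMulLog Q.A Q.B Q.measurable_A
    Q.measurable_B ?_ Q.cover Q.zeroError)
  refine (tsum_meas_le_meas_iUnion_of_disjoint₀ uniformLaw
    (fun i => ((Q.measurable_A i).prod (Q.measurable_B i)).nullMeasurableSet)
    (fun i j hij => Q.disjoint i j hij)).trans prob_le_one

/-! ### Protocols as trees of rectangles, and the cost bound. -/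

namespace Protocol

/-- The observations of node 1 compatible with a history. -/
def nodeOneSet (P : Protocol) : List ℕ → Set ℝ
  | [] => univ
  | s :: h =>
    match P h with
    | .halt _ => ∅
    | .send .node1 _ m _ => P.nodeOneSet h ∩ {x | (m x : ℕ) = s}
    | .send .node2 _ _ _ => P.nodeOneSet h
    -- The leader always observes 0, so this condition keeps everything or nothing.
    | .send .leader _ m _ => P.nodeOneSet h ∩ {_x | (m 0 : ℕ) = s}

/-- The observations of node 2 compatible with a history. -/
def nodeTwoSet (P : Protocol) : List ℕ → Set ℝ
  | [] => univ
  | s :: h =>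
    match P h with
    | .halt _ => ∅
    | .send .node1 _ _ _ => P.nodeTwoSet h
    | .send .node2 _ m _ => P.nodeTwoSet h ∩ {y | (m y : ℕ) = s}
    | .send .leader _ _ _ => P.nodeTwoSet h

/-- The product of the inverse alphabet sizes along a history, with value `0` if the history is
impossible because a symbol is outside its alphabet or the session ended before. -/
noncomputable def weight (P : Protocol) : List ℕ → ℝ
  | [] => 1
  | s :: h =>
    match P h with
    | .halt _ => 0
    | .send _ k _ _ => if s < k then P.weight h / k else 0

/-- The histories at which the session ends. -/
def IsLeaf (P : Protocol) (h : List ℕ) : Prop := ∃ c, P h = Move.halt c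

theorem measurableSet_symbol {k : ℕ} {m : ℝ → Fin k} (hm : Measurable m) (s : ℕ) :
    MeasurableSet {x | (m x : ℕ) = s} :=
  hm (MeasurableSet.of_discrete (s := {i : Fin k | (i : ℕ) = s}))

theorem measurableSet_nodeOneSet (P : Protocol) (h : List ℕ) : MeasurableSet (P.nodeOneSet h) := by
  induction h with
  | nil => exact MeasurableSet.univ
  | cons s h ih =>
    rw [nodeOneSet]
    split
    · exact MeasurableSet.empty
    · exact ih.inter (measurableSet_symbol ‹_› s)
    · exact ih
    · exact ih.inter (MeasurableSet.const _)

theorem measurableSet_nodeTwoSet (P : Protocol) (h : List ℕ) : MeasurableSet (P.nodeTwoSet h) := by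
  induction h with
  | nil => exact MeasurableSet.univ
  | cons s h ih =>
    rw [nodeTwoSet]
    split
    · exact MeasurableSet.empty
    · exact ih
    · exact ih.inter (measurableSet_symbol ‹_› s)
    · exact ih

theorem length_history_le (P : Protocol) (x : ℝ × ℝ) (t : ℕ) : (P.history x t).length ≤ t := by
  induction t with
  | zero => exact le_rfl
  | succ t ih =>
    rw [history]
    split
    · omega
    · simp only [List.length_cons]; omega

theorem history_of_isLeaf (P : Protocol) (x : ℝ × ℝ) {t : ℕ} (ht : P.IsLeaf (P.history x t))
    {u : ℕ} (hu : t ≤ u) : P.history x u = P.history x t := by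
  induction u, hu using Nat.le_induction with
  | base => rfl
  | succ u _ ih =>
    obtain ⟨c, hc⟩ := ht
    rw [history, ih, hc]

/-- Each step adds at most one symbol, so a history of length `n` seen at time `n` has had no idle
step; its length serves as the clock. -/
theorem history_succ_eq_cons_iff (P : Protocol) (x : ℝ × ℝ) (s : ℕ) (h : List ℕ) :
    P.history x (h.length + 1) = s :: h ↔ P.history x h.length = h ∧
      ∃ p k m hm, P h = Move.send p k m hm ∧ (m (p.observation x) : ℕ) = s := by
  have hl := P.length_history_le x h.length
  rw [history]
  split
  next c hc =>
    constructor
    · intro e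
      rw [e] at hl
      simp at hl
    · rintro ⟨e, p, k, m, hm, h1, -⟩
      rw [e, h1] at hc
      cases hc
  next p k m hm hc =>
    constructor
    · intro e
      obtain ⟨e1, e2⟩ := List.cons_eq_cons.1 e
      exact ⟨e2, p, k, m, hm, e2 ▸ hc, e1⟩
    · rintro ⟨e, p', k', m', hm', h1, h2⟩
      rw [e, h1] at hc
      cases hc
      rw [e, h2]

/-- The rectangle property: each symbol constrains the observation of its sender only. -/
theorem mem_nodeSets_iff (P : Protocol) (x : ℝ × ℝ) (h : List ℕ) :
    x ∈ P.nodeOneSet h ×ˢ P.nodeTwoSet h ↔ P.history x h.length = h := by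
  induction h with
  | nil => simp [nodeOneSet, nodeTwoSet, history]
  | cons s h ih =>
    rw [List.length_cons, history_succ_eq_cons_iff, ← ih, nodeOneSet, nodeTwoSet]
    rcases hP : P h with c | ⟨p, k, m, hm⟩
    · simp
    · have he : (∃ p' k' m' hm', Move.send p k m hm = Move.send p' k' m' hm' ∧
          (m' (p'.observation x) : ℕ) = s) ↔ (m (p.observation x) : ℕ) = s := by
        constructor
        · rintro ⟨p', k', m', hm', h1, h2⟩
          cases h1
          exact h2
        · exact fun h2 => ⟨p, k, m, hm, rfl, h2⟩
      rw [he]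
      cases p <;> simp only [Party.observation, mem_prod, mem_inter_iff, mem_ofPred_eq] <;> tauto

theorem history_length_history (P : Protocol) (x : ℝ × ℝ) (t : ℕ) :
    P.history x (P.history x t).length = P.history x t := by
  induction t with
  | zero => rfl
  | succ t ih =>
    rw [history]
    split
    next c hc => exact ih
    next p k m hm hc =>
      exact (P.history_succ_eq_cons_iff x _ _).2 ⟨ih, p, k, m, hm, hc, rfl⟩

/-- Each symbol out of `k` multiplies the weight by `1/k` and costs `log₂ k`. On a history that
really occurs all symbols lie in their alphabets, so no factor vanishes. -/
theorem weight_and_bits_of_history_eq (P : Protocol) (x : ℝ × ℝ) (h : List ℕ)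
    (hx : P.history x h.length = h) :
    0 < P.weight h ∧ P.weight h ≤ 1 ∧
      ∑ t ∈ Finset.range h.length, (P (P.history x t)).bits =
        ENNReal.ofReal (-Real.log (P.weight h) / Real.log 2) := by
  induction h with
  | nil => simp [weight]
  | cons s h ih =>
    rw [List.length_cons, history_succ_eq_cons_iff] at hx
    obtain ⟨hx, p, k, m, hm, hP, hs⟩ := hx
    obtain ⟨w0, w1, hw⟩ := ih hx
    have hsk : s < k := hs ▸ (m (p.observation x)).isLt
    have hk : (1 : ℝ) ≤ k := by exact_mod_cast (by omega : 1 ≤ k)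
    have e : P.weight (s :: h) = P.weight h / k := by simp [weight, hP, hsk]
    rw [e, List.length_cons, Finset.sum_range_succ, hw, hx, hP]
    refine ⟨by positivity, (div_le_self w0.le hk).trans w1, ?_⟩
    have hl : 0 < Real.log 2 := Real.log_pos one_lt_two
    rw [Move.bits, ← ENNReal.ofReal_add
      (div_nonneg (neg_nonneg.2 (Real.log_nonpos w0.le w1)) hl.le)
      (Real.logb_nonneg one_lt_two hk), Real.log_div w0.ne' (by positivity), Real.logb]
    congr 1; ring

theorem tsum_weight_cons_of_isLeaf (P : Protocol) {h : List ℕ} (hh : P.IsLeaf h) :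
    ∑' s, ENNReal.ofReal (P.weight (s :: h)) = 0 := by
  obtain ⟨c, hc⟩ := hh
  simp [weight, hc]

/-- A sending node divides its weight equally among its `k` children; a leaf passes nothing on. -/
theorem tsum_weight_cons_le (P : Protocol) (h : List ℕ) :
    ∑' s, ENNReal.ofReal (P.weight (s :: h)) ≤ ENNReal.ofReal (P.weight h) := by
  rcases hP : P h with c | ⟨p, k, m, hm⟩
  · rw [tsum_weight_cons_of_isLeaf P ⟨c, hP⟩]; exact zero_le
  · have hk : (k : ℝ) ≠ 0 := by
      have := (m 0).pos
      exact_mod_cast this.ne'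
    simp only [weight, hP]
    rw [tsum_eq_sum (s := Finset.range k) (fun s hs => by
      rw [if_neg (by simpa using hs), ENNReal.ofReal_zero]),
      Finset.sum_congr rfl (fun s hs => by rw [if_pos (Finset.mem_range.1 hs)]),
      Finset.sum_const, Finset.card_range, nsmul_eq_mul, ← ENNReal.ofReal_natCast,
      ← ENNReal.ofReal_mul (Nat.cast_nonneg k), mul_div_cancel₀ _ hk]

open Classical in
/-- **Kraft's inequality**: the total weight of the leaves is at most one. -/
theorem tsum_weight_leaf_le_one (P : Protocol) :
    ∑' h, (if P.IsLeaf h then ENNReal.ofReal (P.weight h) else 0) ≤ 1 := by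
  let w : List ℕ → ℝ≥0∞ := fun h => ENNReal.ofReal (P.weight h)
  let total : ℕ → ℝ≥0∞ := fun n => ∑' h : List ℕ, if h.length = n then w h else 0
  let leaves : ℕ → ℝ≥0∞ :=
    fun n => ∑' h : List ℕ, if h.length = n then (if P.IsLeaf h then w h else 0) else 0
  -- The weight at depth `n` pays for the leaves at that depth and for everything at depth `n + 1`,
  -- so leaf weights accumulate against the root weight 1.
  have hstep : ∀ n, total (n + 1) + leaves n ≤ total n := by
    intro n
    have hinj : Function.Injective fun p : List ℕ × ℕ => p.2 :: p.1 := by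
      rintro ⟨h, s⟩ ⟨h', s'⟩ e
      obtain ⟨e1, e2⟩ := List.cons_eq_cons.1 e
      exact Prod.ext e2 e1
    have hcons : total (n + 1) =
        ∑' h : List ℕ, if h.length = n then ∑' s, w (s :: h) else 0 := by
      simp only [total]
      rw [← hinj.tsum_eq, ENNReal.tsum_prod']
      · refine tsum_congr fun h => ?_
        by_cases hh : h.length = n <;> simp [hh]
      · intro h hh
        rcases h with _ | ⟨s, h⟩
        · simp at hh
        · exact ⟨(h, s), rfl⟩
    rw [hcons, ← ENNReal.tsum_add]
    refine ENNReal.tsum_le_tsum fun h => ?_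
    by_cases hh : h.length = n
    · simp only [hh, if_true]
      by_cases hl : P.IsLeaf h
      · rw [if_pos hl, P.tsum_weight_cons_of_isLeaf hl, zero_add]
      · rw [if_neg hl, add_zero]; exact P.tsum_weight_cons_le h
    · simp [hh]
  have hpart : ∀ n, total n + ∑ i ∈ Finset.range n, leaves i ≤ 1 := by
    intro n
    induction n with
    | zero =>
      have : total 0 = 1 := by
        simp only [total, List.length_eq_zero_iff]
        rw [tsum_ite_eq]
        simp [w, weight]
      simp [this]
    | succ n ih =>
      rw [Finset.sum_range_succ, add_comm (∑ i ∈ _, _), ← add_assoc]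
      exact (add_le_add (hstep n) le_rfl).trans ih
  calc ∑' h, (if P.IsLeaf h then ENNReal.ofReal (P.weight h) else 0) = ∑' n, leaves n := by
        simp only [leaves]
        rw [ENNReal.tsum_comm]
        refine tsum_congr fun h => ?_
        simp_rw [eq_comm (a := h.length)]
        rw [tsum_ite_eq]
    _ ≤ 1 := ENNReal.tsum_le_of_sum_range_le fun n => le_add_self.trans (hpart n)

/-- The pointwise form of Gibbs' inequality. -/
theorem negMulLog_add_le {p w : ℝ} (hp : 0 ≤ p) (hw : 0 < w) :
    Real.negMulLog p + p ≤ p * (-Real.log w) + w := by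
  rcases hp.eq_or_lt with rfl | hp
  · simpa using hw.le
  have h := Real.log_le_sub_one_of_pos (div_pos hw hp)
  rw [Real.log_div hw.ne' hp.ne'] at h
  have h2 := mul_le_mul_of_nonneg_left h hp.le
  have e : p * (w / p - 1) = w - p := by field_simp
  rw [e] at h2
  rw [Real.negMulLog]; linarith

theorem four_le_sumRate (P : Protocol) (hP : P.ZeroError) : 4 ≤ P.sumRate := by
  let ι := {h : List ℕ // P.IsLeaf h}
  let A : ι → Set ℝ := fun h => P.nodeOneSet h
  let B : ι → Set ℝ := fun h => P.nodeTwoSet h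
  have hm : ∀ i, MeasurableSet (A i ×ˢ B i) := fun i =>
    (P.measurableSet_nodeOneSet i).prod (P.measurableSet_nodeTwoSet i)
  have hmem : ∀ (i : ι) x, x ∈ A i ×ˢ B i ↔ P.history x i.1.length = i.1 :=
    fun i x => P.mem_nodeSets_iff x i
  have hmem' : ∀ (i : ι) x, x ∈ A i ×ˢ B i → ∀ t, P.IsLeaf (P.history x t) →
      P.history x t = i.1 := by
    intro i x hx t ht
    rw [hmem] at hx
    have hi : P.IsLeaf (P.history x i.1.length) := by rw [hx]; exact i.2
    rcases le_total t i.1.length with h | h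
    · rw [← P.history_of_isLeaf x ht h, hx]
    · rw [P.history_of_isLeaf x hi h, hx]
  have hdisj : Pairwise (Function.onFun Disjoint fun i => A i ×ˢ B i) := by
    intro i j hij
    refine Set.disjoint_left.2 fun x hi hj => hij (Subtype.ext ?_)
    have h1 := (hmem i x).1 hi
    have h2 := hmem' j x hj i.1.length (by rw [h1]; exact i.2)
    exact h1.symm.trans h2
  have hcover : ∀ᵐ x ∂uniformLaw, ∃ i, x ∈ A i ×ˢ B i := by
    filter_upwards [hP] with x hx
    obtain ⟨t, c, h1, -⟩ := hx
    exact ⟨⟨P.history x t, c, h1⟩, (hmem _ x).2 (P.history_length_history x t)⟩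
  have hunion : uniformLaw (⋃ i, A i ×ˢ B i) = 1 := by
    rw [← measure_univ (μ := uniformLaw)]
    exact measure_congr (hcover.mono fun x hx =>
      propext ⟨fun _ => mem_univ x, fun _ => mem_iUnion.2 hx⟩)
  have hsum : ∑' i, uniformLaw (A i ×ˢ B i) = 1 := by
    rw [← measure_iUnion hdisj hm, hunion]
  have hmono : ∀ i, (∀ᵐ x ∂uniformLaw, x ∈ A i ×ˢ B i → x.1 ≥ x.2) ∨
      (∀ᵐ x ∂uniformLaw, x ∈ A i ×ˢ B i → x.1 < x.2) := by
    intro i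
    obtain ⟨c, hc⟩ := i.2
    have : ∀ᵐ x ∂uniformLaw, x ∈ A i ×ˢ B i → (c = true ↔ x.1 ≥ x.2) := by
      filter_upwards [hP] with x hx hxi
      obtain ⟨t, c', h1, h2⟩ := hx
      have := hmem' i x hxi t ⟨c', h1⟩
      rw [this, hc] at h1
      cases h1
      exact h2
    cases c
    · exact Or.inr (this.mono fun x hx hxi => by simpa using hx hxi)
    · exact Or.inl (this.mono fun x hx hxi => by simpa using hx hxi)
  have hent := four_log_two_le_tsum_negMulLog A B (fun i => P.measurableSet_nodeOneSet i)
    (fun i => P.measurableSet_nodeTwoSet i) hsum.le hcover hmono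
  let cost : ι → ℝ := fun i => -Real.log (P.weight i.1)
  have hkraft : ∑' i : ι, ENNReal.ofReal (P.weight i.1) ≤ 1 := by
    classical
    refine le_of_eq_of_le ?_ P.tsum_weight_leaf_le_one
    refine (tsum_subtype {h | P.IsLeaf h} fun h => ENNReal.ofReal (P.weight h)).trans ?_
    refine tsum_congr fun h => ?_
    simp [indicator]
  -- Subtraction is avoided in `ℝ≥0∞`: the probabilities, of sum 1, stay on the left and the
  -- weights, of sum at most 1, on the right; the 1 is cancelled after summation.
  have hgibbs : ∀ i : ι, ENNReal.ofReal (Real.negMulLog (uniformLaw (A i ×ˢ B i)).toReal)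
      + uniformLaw (A i ×ˢ B i) ≤
      ENNReal.ofReal ((uniformLaw (A i ×ˢ B i)).toReal * cost i)
        + ENNReal.ofReal (P.weight i.1) := by
    intro i
    -- An impossible leaf may have weight 0, where Gibbs' inequality is not available.
    rcases (A i ×ˢ B i).eq_empty_or_nonempty with he | ⟨x, hx⟩
    · simp [he]
    obtain ⟨w0, w1, -⟩ := P.weight_and_bits_of_history_eq x i.1 ((hmem i x).1 hx)
    have hp0 : 0 ≤ (uniformLaw (A i ×ˢ B i)).toReal := ENNReal.toReal_nonneg
    have hp1 : (uniformLaw (A i ×ˢ B i)).toReal ≤ 1 := by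
      rw [← ENNReal.toReal_one]
      exact ENNReal.toReal_mono ENNReal.one_ne_top prob_le_one
    nth_rewrite 2 [← ENNReal.ofReal_toReal (measure_ne_top uniformLaw (A i ×ˢ B i))]
    rw [← ENNReal.ofReal_add (Real.negMulLog_nonneg hp0 hp1) hp0,
      ← ENNReal.ofReal_add (mul_nonneg hp0 (neg_nonneg.2 (Real.log_nonpos w0.le w1))) w0.le]
    exact ENNReal.ofReal_le_ofReal (negMulLog_add_le hp0 w0)
  have hcost : ENNReal.ofReal (4 * Real.log 2) ≤
      ∑' i, ENNReal.ofReal ((uniformLaw (A i ×ˢ B i)).toReal * cost i) := by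
    refine hent.trans ((ENNReal.add_le_add_iff_right ENNReal.one_ne_top).1 ?_)
    calc _ = ∑' i, (ENNReal.ofReal (Real.negMulLog (uniformLaw (A i ×ˢ B i)).toReal)
          + uniformLaw (A i ×ˢ B i)) := by rw [ENNReal.tsum_add, hsum]
      _ ≤ ∑' i, (ENNReal.ofReal ((uniformLaw (A i ×ˢ B i)).toReal * cost i)
          + ENNReal.ofReal (P.weight i.1)) := ENNReal.tsum_le_tsum hgibbs
      _ ≤ _ := by rw [ENNReal.tsum_add]; gcongr
  refine (four_le_of_four_log_two_le hcost).trans ?_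
  calc ∑' i, ENNReal.ofReal ((uniformLaw (A i ×ˢ B i)).toReal * cost i / Real.log 2)
      ≤ ∑' i, ∫⁻ x in A i ×ˢ B i, P.totalBits x ∂uniformLaw := by
        refine ENNReal.tsum_le_tsum fun i => ?_
        rw [mul_div_assoc, ENNReal.ofReal_mul ENNReal.toReal_nonneg,
          ENNReal.ofReal_toReal (measure_ne_top _ _), mul_comm, ← setLIntegral_const]
        refine setLIntegral_mono' (hm i) fun x hx => ?_
        rw [← (P.weight_and_bits_of_history_eq x i.1 ((hmem i x).1 hx)).2.2]
        exact ENNReal.sum_le_tsum _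
    _ = ∫⁻ x in ⋃ i, A i ×ˢ B i, P.totalBits x ∂uniformLaw :=
        (lintegral_iUnion hm hdisj _).symm
    _ ≤ P.sumRate := setLIntegral_le_lintegral _ _

end Protocol

/-! ### Correctness and cost of bit exchange. -/

theorem binaryRemainder_mem {x : ℝ} (hx : x ∈ Ico (0 : ℝ) 1) (j : ℕ) :
    binaryRemainder x j ∈ Ico (0 : ℝ) 1 := by
  induction j with
  | zero => exact hx
  | succ j _ => exact ⟨Int.fract_nonneg _, Int.fract_lt_one _⟩

theorem floor_two_mul_binaryRemainder {x : ℝ} (hx : x ∈ Ico (0 : ℝ) 1) (j : ℕ) :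
    ⌊2 * binaryRemainder x j⌋ = ((binaryDigit j x : ℕ) : ℤ) := by
  have hr := binaryRemainder_mem hx j
  have h0 : 0 ≤ 2 * binaryRemainder x j := by linarith [hr.1]
  have h2 : ⌊2 * binaryRemainder x j⌋₊ < 2 := by
    rw [Nat.floor_lt h0]; push_cast; linarith [hr.2]
  rw [binaryDigit, Fin.val_ofNat, Nat.mod_eq_of_lt h2, Int.natCast_floor_eq_floor h0]

/-- The first `j` binary digits of the two coordinates agree. -/
def agreeSet (j : ℕ) : Set (ℝ × ℝ) := {x | ∀ i < j, binaryDigit i x.1 = binaryDigit i x.2}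

theorem measurableSet_agreeSet (j : ℕ) : MeasurableSet (agreeSet j) := by
  have : agreeSet j =
      ⋂ i ∈ Finset.range j, {x : ℝ × ℝ | binaryDigit i x.1 = binaryDigit i x.2} := by
    ext x; simp [agreeSet]
  rw [this]
  exact Finset.measurableSet_biInter _ fun i _ => measurableSet_eq_fun
    ((measurable_binaryDigit i).comp measurable_fst)
    ((measurable_binaryDigit i).comp measurable_snd)

/-- Each side is the integer written by the first `j` binary digits. -/
theorem sub_binaryRemainder_eq_of_mem_agreeSet {x y : ℝ} (hx : x ∈ Ico (0 : ℝ) 1)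
    (hy : y ∈ Ico (0 : ℝ) 1) {j : ℕ} (h : (x, y) ∈ agreeSet j) :
    2 ^ j * x - binaryRemainder x j = 2 ^ j * y - binaryRemainder y j := by
  induction j with
  | zero => simp [binaryRemainder]
  | succ j ih =>
    have ih := ih fun i hi => h i (by omega)
    have hd : binaryDigit j x = binaryDigit j y := h j (by omega)
    rw [binaryRemainder, binaryRemainder, floor_two_mul_binaryRemainder hx,
      floor_two_mul_binaryRemainder hy, hd, pow_succ]
    linarith

/-- For fixed `x`, the `y` sharing its first `j` digits lie in one dyadic interval of length `2⁻ʲ`.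
-/
theorem uniformLaw_agreeSet_le (j : ℕ) : uniformLaw (agreeSet j) ≤ 2⁻¹ ^ j := by
  rw [uniformLaw, Measure.prod_apply (measurableSet_agreeSet j)]
  calc ∫⁻ x in Ico (0 : ℝ) 1, (volume.restrict (Ico (0 : ℝ) 1)) (Prod.mk x ⁻¹' agreeSet j)
      ≤ ∫⁻ _ in Ico (0 : ℝ) 1, (2⁻¹ ^ j : ℝ≥0∞) := by
        refine setLIntegral_mono' measurableSet_Ico fun x hx => ?_
        rw [Measure.restrict_apply (measurable_prodMk_left (measurableSet_agreeSet j))]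
        set m := 2 ^ j * x - binaryRemainder x j with hm
        have hsub : Prod.mk x ⁻¹' agreeSet j ∩ Ico 0 1 ⊆ Ico (m / 2 ^ j) ((m + 1) / 2 ^ j) := by
          rintro y ⟨hxy, hy⟩
          have e := sub_binaryRemainder_eq_of_mem_agreeSet hx hy hxy
          have hr := binaryRemainder_mem hy j
          rw [← hm] at e
          refine ⟨?_, ?_⟩
          · rw [div_le_iff₀ (by positivity)]; linarith [hr.1]
          · rw [lt_div_iff₀ (by positivity)]; linarith [hr.2]
        refine (measure_mono hsub).trans_eq ?_
        rw [Real.volume_Ico, ← sub_div, add_sub_cancel_left, one_div, ← inv_pow,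
          ENNReal.ofReal_pow (by norm_num), ENNReal.ofReal_inv_of_pos two_pos,
          ENNReal.ofReal_ofNat]
    _ = 2⁻¹ ^ j := by simp

theorem bits_sendDigit (s : Party) (j : ℕ) : (sendDigit s j).bits = 1 := by
  simp [sendDigit, Move.bits]

theorem bitExchange_of_odd {h : List ℕ} (ho : h.length % 2 = 1) :
    bitExchange h = sendDigit .node2 (h.length / 2) := by
  unfold bitExchange
  exact if_pos ho

/-- The inductive step for following a run: the length of the history encodes the round, so it is
carried along. -/
theorem bitExchange_round (x : ℝ × ℝ) (j : ℕ) (hl : (bitExchange.history x (2 * j)).length = 2 * j)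
    (hs : bitExchange (bitExchange.history x (2 * j)) = sendDigit .node1 j) :
    bitExchange (bitExchange.history x (2 * j + 1)) = sendDigit .node2 j ∧
    (bitExchange.history x (2 * (j + 1))).length = 2 * (j + 1) ∧
    bitExchange (bitExchange.history x (2 * (j + 1))) =
      if binaryDigit j x.1 = binaryDigit j x.2 then sendDigit .node1 (j + 1)
      else .halt (decide (binaryDigit j x.1 > binaryDigit j x.2)) := by
  have h1 : bitExchange.history x (2 * j + 1) =
      (binaryDigit j x.1 : ℕ) :: bitExchange.history x (2 * j) := by
    rw [Protocol.history, hs]; rfl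
  have e1 : bitExchange (bitExchange.history x (2 * j + 1)) = sendDigit .node2 j := by
    rw [bitExchange_of_odd (by rw [h1, List.length_cons, hl]; omega), h1, List.length_cons, hl]
    congr 1; omega
  have h2 : bitExchange.history x (2 * (j + 1)) =
      (binaryDigit j x.2 : ℕ) :: (binaryDigit j x.1 : ℕ) :: bitExchange.history x (2 * j) := by
    rw [show 2 * (j + 1) = 2 * j + 1 + 1 by ring, Protocol.history, e1, ← h1]; rfl
  refine ⟨e1, by rw [h2]; simp [hl]; ring, ?_⟩
  rw [h2, bitExchange, if_neg (by simp [hl]; omega)]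
  simp only [List.length_cons, hl, Fin.val_inj, gt_iff_lt, Fin.val_fin_lt]
  rw [show (2 * j + 1 + 1) / 2 = j + 1 by omega]

theorem bitExchange_of_mem_agreeSet {x : ℝ × ℝ} {j : ℕ} (h : x ∈ agreeSet j) :
    (bitExchange.history x (2 * j)).length = 2 * j ∧
      bitExchange (bitExchange.history x (2 * j)) = sendDigit .node1 j := by
  induction j with
  | zero => exact ⟨rfl, by simp [Protocol.history, bitExchange]⟩
  | succ j ih =>
    obtain ⟨hl, hs⟩ := ih fun i hi => h i (by omega)
    obtain ⟨-, h2, h3⟩ := bitExchange_round x j hl hs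
    rw [if_pos (h j (by omega))] at h3
    exact ⟨h2, h3⟩

theorem exists_first_disagreement {x : ℝ × ℝ} {j : ℕ} (h : x ∉ agreeSet j) :
    ∃ i < j, x ∈ agreeSet i ∧ binaryDigit i x.1 ≠ binaryDigit i x.2 := by
  classical
  have hex : ∃ i, i < j ∧ binaryDigit i x.1 ≠ binaryDigit i x.2 := by
    simpa [agreeSet] using h
  obtain ⟨hi, hne⟩ := Nat.find_spec hex
  refine ⟨Nat.find hex, hi, fun i' hi' => ?_, hne⟩
  by_contra hc
  exact Nat.find_min hex hi' ⟨by omega, hc⟩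

theorem bitExchange_halt {x : ℝ × ℝ} {i : ℕ} (h : x ∈ agreeSet i)
    (hne : binaryDigit i x.1 ≠ binaryDigit i x.2) :
    bitExchange (bitExchange.history x (2 * (i + 1))) =
      .halt (decide (binaryDigit i x.1 > binaryDigit i x.2)) := by
  obtain ⟨hl, hs⟩ := bitExchange_of_mem_agreeSet h
  rw [(bitExchange_round x i hl hs).2.2, if_neg hne]

/-- Round `j` takes place exactly when the first `j` digits agree; otherwise the history is frozen
at a halt, which costs nothing. -/
theorem bitExchange_bits (x : ℝ × ℝ) (j : ℕ) :
    (bitExchange (bitExchange.history x (2 * j))).bits = (agreeSet j).indicator 1 x ∧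
      (bitExchange (bitExchange.history x (2 * j + 1))).bits = (agreeSet j).indicator 1 x := by
  by_cases h : x ∈ agreeSet j
  · obtain ⟨hl, hs⟩ := bitExchange_of_mem_agreeSet h
    rw [hs, (bitExchange_round x j hl hs).1, bits_sendDigit, bits_sendDigit,
      indicator_of_mem h]
    exact ⟨rfl, rfl⟩
  · obtain ⟨i, hij, hi, hne⟩ := exists_first_disagreement h
    have hh := bitExchange_halt hi hne
    rw [bitExchange.history_of_isLeaf x ⟨_, hh⟩ (by omega : 2 * (i + 1) ≤ 2 * j),
      bitExchange.history_of_isLeaf x ⟨_, hh⟩ (by omega : 2 * (i + 1) ≤ 2 * j + 1), hh,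
      indicator_of_notMem h]
    exact ⟨rfl, rfl⟩

theorem totalBits_bitExchange (x : ℝ × ℝ) :
    bitExchange.totalBits x = ∑' j, 2 * (agreeSet j).indicator 1 x := by
  rw [Protocol.totalBits, ← tsum_even_add_odd ENNReal.summable ENNReal.summable,
    ← ENNReal.tsum_add]
  refine tsum_congr fun j => ?_
  rw [(bitExchange_bits x j).1, (bitExchange_bits x j).2, two_mul]

theorem sumRate_bitExchange_le : bitExchange.sumRate ≤ 4 := by
  simp only [Protocol.sumRate, totalBits_bitExchange]
  have hm : ∀ j, Measurable ((agreeSet j).indicator (1 : ℝ × ℝ → ℝ≥0∞)) := fun j =>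
    measurable_one.indicator (measurableSet_agreeSet j)
  rw [lintegral_tsum fun j => ((hm j).const_mul 2).aemeasurable]
  calc ∑' j, ∫⁻ x, 2 * (agreeSet j).indicator 1 x ∂uniformLaw
      ≤ ∑' j, 2 * (2⁻¹ : ℝ≥0∞) ^ j := by
        refine ENNReal.tsum_le_tsum fun j => ?_
        rw [lintegral_const_mul _ (hm j), lintegral_indicator_one (measurableSet_agreeSet j)]
        gcongr
        exact uniformLaw_agreeSet_le j
    _ = 4 := by
        rw [ENNReal.tsum_mul_left, ENNReal.tsum_geometric, ENNReal.one_sub_inv_two, inv_inv]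
        norm_num

theorem ae_uniformLaw_ne : ∀ᵐ x ∂uniformLaw, x.1 ≠ x.2 := by
  have hd : MeasurableSet {x : ℝ × ℝ | x.1 ≠ x.2} :=
    (measurableSet_eq_fun measurable_fst measurable_snd).compl
  rw [uniformLaw, Measure.ae_prod_iff_ae_ae hd]
  refine Filter.Eventually.of_forall fun x => ?_
  exact (Measure.ae_ne _ x).mono fun y hy => hy.symm

theorem ae_uniformLaw_mem : ∀ᵐ x ∂uniformLaw, x ∈ Ico (0 : ℝ) 1 ×ˢ Ico (0 : ℝ) 1 := by
  rw [uniformLaw, Measure.prod_restrict]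
  exact ae_restrict_mem (measurableSet_Ico.prod measurableSet_Ico)

theorem zeroError_bitExchange : bitExchange.ZeroError := by
  filter_upwards [ae_uniformLaw_ne, ae_uniformLaw_mem] with x hne hx
  -- Agreement of the first `n` digits forces `|x₁ - x₂| < 2⁻ⁿ`, so distinct numbers disagree
  -- somewhere.
  obtain ⟨n, hn⟩ : ∃ n, x ∉ agreeSet n := by
    by_contra! hall
    obtain ⟨n, hn⟩ := exists_pow_lt_of_lt_one (abs_pos.2 (sub_ne_zero.2 hne))
      (by norm_num : (2⁻¹ : ℝ) < 1)
    have e := sub_binaryRemainder_eq_of_mem_agreeSet hx.1 hx.2 (hall n)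
    have h1 := binaryRemainder_mem hx.1 n
    have h2 := binaryRemainder_mem hx.2 n
    have h3 : |2 ^ n * (x.1 - x.2)| < 1 := by
      rw [abs_lt]; constructor <;> linarith [h1.1, h1.2, h2.1, h2.2]
    rw [abs_mul, abs_of_pos (by positivity : (0 : ℝ) < 2 ^ n)] at h3
    rw [inv_pow, inv_lt_iff_one_lt_mul₀ (by positivity)] at hn
    linarith
  obtain ⟨i, -, hi, hd⟩ := exists_first_disagreement hn
  refine ⟨_, _, bitExchange_halt hi hd, ?_⟩
  have e := sub_binaryRemainder_eq_of_mem_agreeSet hx.1 hx.2 hi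
  have f1 := floor_two_mul_binaryRemainder hx.1 i
  have f2 := floor_two_mul_binaryRemainder hx.2 i
  -- With equal integer parts of `2^i u` and `2^i v`, the order is that of the remainders, which the
  -- next digit reveals when it differs.
  have mono : ∀ {u v : ℝ}, u ∈ Ico (0 : ℝ) 1 → v ∈ Ico (0 : ℝ) 1 →
      2 ^ i * u - binaryRemainder u i = 2 ^ i * v - binaryRemainder v i →
      binaryDigit i u < binaryDigit i v → u < v := by
    intro u v hu hv e h
    have h' : ⌊2 * binaryRemainder u i⌋ < ⌊2 * binaryRemainder v i⌋ := by
      rw [floor_two_mul_binaryRemainder hu, floor_two_mul_binaryRemainder hv]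
      exact_mod_cast h
    have hr : binaryRemainder u i < binaryRemainder v i := by
      by_contra hc
      exact absurd (Int.floor_le_floor (by linarith)) (not_le.2 h')
    have : (2 : ℝ) ^ i * u < 2 ^ i * v := by linarith
    exact lt_of_mul_lt_mul_left this (by positivity)
  rw [decide_eq_true_iff]
  constructor
  · exact fun h => (mono hx.2 hx.1 e.symm h).le
  · intro h
    by_contra hc
    exact absurd (mono hx.1 hx.2 e (lt_of_le_of_ne (not_lt.1 hc) hd)) (not_lt.2 h)

/-- Deciding whether `X₁ ≥ X₂` for independent uniform `X₁`, `X₂`: every zero-error interactive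
protocol has sum rate at least `4` bits, every zero-error rectangular partition has entropy at
least `4` bits, and the bit-exchange protocol is a zero-error protocol of sum rate `4` bits. -/
theorem mainTheorem3 :
    (∀ P : Protocol, P.ZeroError → 4 ≤ P.sumRate) ∧
    (∀ Q : ZeroErrorPartition, 4 ≤ Q.entropy) ∧
    bitExchange.ZeroError ∧ bitExchange.sumRate = 4 :=
  ⟨Protocol.four_le_sumRate, ZeroErrorPartition.four_le_entropy, zeroError_bitExchange,
    le_antisymm sumRate_bitExchange_le (Protocol.four_le_sumRate _ zeroError_bitExchange)⟩
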